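/- Let $(X,d,\mathfrak m)$ be a metric measure space, i.e. $(X,d)$ is a complete separable metric space and $\mathfrak m$ is a locally finite (non-negative) Borel measure on $X$ with full support, and assume that $X$ is non-compact. For a probability measure $\mu$ on $X$ let $\mathrm{Ent}_{\mathfrak m}(\mu)=\int\rho\ln\rho\,d\mathfrak m$ if $\mu=\rho\,\mathfrak m$, and $\mathrm{Ent}_{\mathfrak m}(\mu)=+\infty$ otherwise (the integral is read as $+\infty$ if the positive part of $\rho\ln\rho$ is not integrable). Assume that: (i) $(X,d,\mathfrak m)$ has non-negative Ricci curvature, i.e. satisfies $\mathrm{CD}(0,\infty)$: for any $\mu_0,\mu_1$ in the space $\mathcal P_2(X)$ of Borel probability measures with finite second moment there is a geodesic $(\mu_t)_{t\in[0,1]}$ of constant speed from $\mu_0$ to $\mu_1$ in the $L^2$-Wasserstein space $(\mathcal P_2(X),W_2)$ such that $$\mathrm{Ent}_{\mathfrak m}(\mu_t)\le t\,\mathrm{Ent}_{\mathfrak m}(\mu_1)+(1-t)\,\mathrm{Ent}_{\mathfrak m}(\mu_0)\qquad\text{for all } t\in[0,1],$$ where the inequality is regarded as void if one of $\mathrm{Ent}_{\mathfrak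 m}(\mu_0),\mathrm{Ent}_{\mathfrak m}(\mu_1)$ is $+\infty$; (ii) $(X,d,\mathfrak m)$ has volume entropy $0$: for some $x_0\in X$, with $B_r(x_0)=\{x: d(x,x_0)<r\}$, $$\lim_{r\to+\infty}\frac{\ln\mathfrak m(B_r(x_0))}{r}=0.$$ For a Borel set $\Omega\subset X$ with $\mathfrak m(\Omega)<+\infty$ let $$\mathfrak m^+(\Omega)=\liminf_{\epsilon\to0^+}\frac{\mathfrak m(\Omega^\epsilon)-\mathfrak m(\Omega)}{\epsilon},\qquad \Omega^\epsilon=\{x\in X: d(x,\Omega)<\epsilon\},$$ be its Minkowski content. Then there is no constant $C>0$ such that $$\mathfrak m^+(\Omega)\ge C\,\mathfrak m(\Omega)\qquad\text{for all Borel sets }\Omega\subset X\text{ with }\mathfrak m(\Omega)<+\infty.$$ -/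

import Mathlib

open MeasureTheory Filter Topology Set
open scoped ENNReal

namespace OptimalTransport

variable {X : Type*} [MetricSpace X] [MeasurableSpace X]

/-- Membership in `𝒫₂(X)`: Borel probability measures with finite second moment. -/
def IsP2 (μ : Measure X) : Prop :=
  IsProbabilityMeasure μ ∧ ∃ x₀ : X, ∫⁻ x, edist x x₀ ^ 2 ∂μ < ⊤

/-- `π` is a coupling (transport plan) of `μ` and `ν`. -/
def IsCoupling (μ ν : Measure X) (π : Measure (X × X)) : Prop :=
  π.map Prod.fst = μ ∧ π.map Prod.snd = ν

/-- The `L²`-Wasserstein distance. -/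
noncomputable def W2 (μ ν : Measure X) : ℝ≥0∞ :=
  (⨅ (π : Measure (X × X)) (_ : IsCoupling μ ν π), ∫⁻ p, edist p.1 p.2 ^ 2 ∂π) ^ (1 / 2 : ℝ)

/-- `(μ_t)_{t ∈ [0,1]}` is a (constant speed, minimizing) geodesic of `(𝒫₂(X), W₂)`.
Values of `μ` outside `[0,1]` are irrelevant. -/
def IsW2Geodesic (μ : ℝ → Measure X) : Prop :=
  (∀ t ∈ Icc (0 : ℝ) 1, IsP2 (μ t)) ∧
  ∀ s ∈ Icc (0 : ℝ) 1, ∀ t ∈ Icc (0 : ℝ) 1,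
    W2 (μ s) (μ t) = ENNReal.ofReal |t - s| * W2 (μ 0) (μ 1)

open Classical in
/-- The relative entropy `Ent_m(μ) = ∫ ρ ln ρ dm` if `μ = ρ m`, and `+∞` otherwise. The integral
is the integral of the positive part of `ρ ln ρ` minus that of the negative part; it is `+∞`
whenever the former is infinite, and `-∞` is allowed. -/
noncomputable def relEntropy (m μ : Measure X) : EReal :=
  if μ ≪ m ∧
      ∫⁻ x, ENNReal.ofReal ((μ.rnDeriv m x).toReal * Real.log (μ.rnDeriv m x).toReal) ∂m < ⊤ then
    ((∫⁻ x, ENNReal.ofReal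
        ((μ.rnDeriv m x).toReal * Real.log (μ.rnDeriv m x).toReal) ∂m : ℝ≥0∞) : EReal) -
      ((∫⁻ x, ENNReal.ofReal
        (-((μ.rnDeriv m x).toReal * Real.log (μ.rnDeriv m x).toReal)) ∂m : ℝ≥0∞) : EReal)
  else ⊤

/-- Non-negative Ricci curvature, i.e. the `CD(0, ∞)` condition: any two measures in `𝒫₂(X)` are
joined by a `W₂`-geodesic along which the relative entropy is convex. The convexity inequality has
content only if both endpoints have entropy `< +∞`; this is made explicit, because the sum
`(+∞) + (-∞)` is `-∞` in `EReal`. -/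
def IsCDZeroInfty (m : Measure X) : Prop :=
  ∀ μ₀ μ₁ : Measure X, IsP2 μ₀ → IsP2 μ₁ →
    ∃ μ : ℝ → Measure X, IsW2Geodesic μ ∧ μ 0 = μ₀ ∧ μ 1 = μ₁ ∧
      (relEntropy m μ₀ < ⊤ → relEntropy m μ₁ < ⊤ → ∀ t ∈ Icc (0 : ℝ) 1,
        relEntropy m (μ t) ≤
          (t : EReal) * relEntropy m μ₁ + ((1 - t : ℝ) : EReal) * relEntropy m μ₀)

/-- The space admits the volume entropy `h ∈ [0, ∞]`: for some `x₀`,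
`ln m(B_r(x₀)) / r → h` as `r → +∞` (a limit in the extended reals). -/
def HasVolumeEntropy (m : Measure X) (h : ℝ≥0∞) : Prop :=
  ∃ x₀ : X, Tendsto (fun r : ℝ => ENNReal.log (m (Metric.ball x₀ r)) / (r : EReal))
    atTop (𝓝 (h : EReal))

/-- The Minkowski content `m⁺(Ω) = liminf_{ε → 0⁺} (m(Ω^ε) - m(Ω)) / ε`, where `Ω^ε` is the open
`ε`-neighbourhood. It is used for `m Ω < ∞` only, where the subtraction is the honest one. -/
noncomputable def minkowskiContent (m : Measure X) (Ω : Set X) : ℝ≥0∞ :=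
  liminf (fun ε : ℝ => (m (Metric.thickening ε Ω) - m Ω) / ENNReal.ofReal ε) (𝓝[>] 0)

end OptimalTransport

/-! Test the inequality on balls only. Since the `ε`-neighbourhood of `B_r(x₀)` lies in
`B_{r+ε}(x₀)`, it forces `V(r) = m(B_r(x₀))` to have lower right derivative at least `C V(r)`. A
Gronwall argument for monotone functions, `Monotone.mul_exp_le_of_eventually_right`, turns this into
exponential growth of `V`, which contradicts volume entropy `0`. -/

/-- A monotone function which near every point `x ≥ a` grows to the right at least exponentially
with rate `c` grows globally exponentially with rate `c`. -/
theorem Monotone.mul_exp_le_of_eventually_right {g : ℝ → ℝ} (hg : Monotone g) {a c : ℝ}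
    (hstep : ∀ x, a ≤ x → ∀ᶠ y in 𝓝[>] x, g x * Real.exp (c * (y - x)) ≤ g y)
    {r : ℝ} (hr : a ≤ r) : g a * Real.exp (c * (r - a)) ≤ g r := by
  set P : ℝ → Prop := fun s => g a * Real.exp (c * (s - a)) ≤ g s with hP
  -- Continuous induction: `S` collects the `t` up to which the bound holds, and its supremum is
  -- shown to be `r`.
  set S : Set ℝ := {t | t ∈ Icc a r ∧ ∀ s ∈ Icc a t, P s} with hS
  have haS : a ∈ S := by
    refine ⟨⟨le_rfl, hr⟩, fun s hs => ?_⟩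
    have : s = a := le_antisymm hs.2 hs.1
    subst this
    simp [hP]
  have hbdd : BddAbove S := ⟨r, fun t ht => ht.1.2⟩
  have hb_lub := isLUB_csSup ⟨a, haS⟩ hbdd
  set b := sSup S
  have hab : a ≤ b := hb_lub.1 haS
  have hbr : b ≤ r := hb_lub.2 fun t ht => ht.1.2
  have hlt : ∀ s, a ≤ s → s < b → P s := by
    intro s has hsb
    obtain ⟨t, ht, hst, -⟩ := hb_lub.exists_between hsb
    exact ht.2 s ⟨has, hst.le⟩
  have hPb : P b := by
    rcases hab.eq_or_lt with h | h
    · rw [← h]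
      exact haS.2 a ⟨le_rfl, le_rfl⟩
    -- `g` need not be continuous: by monotonicity it can only jump up, so the bound survives the
    -- limit from the left.
    · have hcont : Tendsto (fun s => g a * Real.exp (c * (s - a))) (𝓝[<] b)
          (𝓝 (g a * Real.exp (c * (b - a)))) :=
        (Continuous.tendsto (by fun_prop) b).mono_left nhdsWithin_le_nhds
      refine _root_.le_of_tendsto hcont ?_
      filter_upwards [Ioo_mem_nhdsLT h] with s hs
      exact (hlt s hs.1.le hs.2).trans (hg hs.2.le)
  rcases hbr.eq_or_lt with h | h
  · exact h ▸ hPb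
  obtain ⟨u, hu, hsub⟩ := mem_nhdsGT_iff_exists_Ioo_subset.1 (hstep b hab)
  obtain ⟨t, hbt, htu⟩ := exists_between (lt_min (mem_Ioi.1 hu) h)
  have htS : t ∈ S := by
    refine ⟨⟨hab.trans hbt.le, htu.le.trans (min_le_right _ _)⟩, fun s hs => ?_⟩
    rcases lt_trichotomy s b with hsb | hsb | hsb
    · exact hlt s hs.1 hsb
    · exact hsb ▸ hPb
    · have h1 : g b * Real.exp (c * (s - b)) ≤ g s :=
        hsub ⟨hsb, hs.2.trans_lt (htu.trans_le (min_le_left _ _))⟩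
      calc g a * Real.exp (c * (s - a))
          = g a * Real.exp (c * (b - a)) * Real.exp (c * (s - b)) := by
            rw [mul_assoc, ← Real.exp_add]; ring_nf
        _ ≤ g b * Real.exp (c * (s - b)) := by gcongr
        _ ≤ g s := h1
  exact absurd (hb_lub.1 htS) hbt.not_ge

theorem Real.exp_le_one_add_two_mul {x : ℝ} (h0 : 0 ≤ x) (h1 : x ≤ 1 / 2) :
    Real.exp x ≤ 1 + 2 * x := by
  refine (Real.exp_bound_div_one_sub_of_interval h0 (by linarith)).trans ?_
  rw [div_le_iff₀ (by linarith)]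
  nlinarith

namespace OptimalTransport

variable {X : Type*} [MetricSpace X] [MeasurableSpace X]

/-- One ball of infinite measure would make the quotient `⊤` for all larger radii, against a finite
limit. -/
theorem HasVolumeEntropy.exists_measure_ball_lt_top {m : Measure X} {h : ℝ≥0∞} (hh : h ≠ ⊤)
    (hent : HasVolumeEntropy m h) : ∃ x₀ : X, (∀ r, m (Metric.ball x₀ r) < ⊤) ∧
      Tendsto (fun r : ℝ => ENNReal.log (m (Metric.ball x₀ r)) / (r : EReal))
        atTop (𝓝 (h : EReal)) := by
  obtain ⟨x₀, hx₀⟩ := hent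
  refine ⟨x₀, fun r => ?_, hx₀⟩
  have hh' : (h : EReal) < ⊤ := lt_top_iff_ne_top.2 (by simpa using hh)
  obtain ⟨s, hs, hs0, hrs⟩ :=
    ((hx₀.eventually_lt_const hh').and ((eventually_gt_atTop 0).and
      (eventually_ge_atTop r))).exists
  refine (measure_mono (Metric.ball_subset_ball hrs)).trans_lt (lt_top_iff_ne_top.2 fun htop => ?_)
  rw [htop, ENNReal.log_top, EReal.top_div_of_pos_ne_top (by exact_mod_cast hs0)
    (EReal.coe_ne_top s)] at hs
  exact lt_irrefl _ hs

/-- If the Minkowski content of the ball of radius `r` is at least `C` times its measure, then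
the measure of concentric balls grows to the right of `r` at rate at least `C / 4`. -/
theorem eventually_measureReal_ball_mul_exp_le {m : Measure X} {x₀ : X}
    (hfin : ∀ r, m (Metric.ball x₀ r) < ⊤) {C : ℝ} (hC : 0 < C) {r : ℝ}
    (hpos : 0 < m (Metric.ball x₀ r))
    (h : ENNReal.ofReal C * m (Metric.ball x₀ r) ≤ minkowskiContent m (Metric.ball x₀ r)) :
    ∀ᶠ s in 𝓝[>] r, m.real (Metric.ball x₀ r) * Real.exp (C / 4 * (s - r)) ≤
      m.real (Metric.ball x₀ s) := by
  -- Half of `C` is given up for a strict inequality below the liminf; another half goes into `exp x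
  -- ≤ 1 + 2x`.
  have hlt : ENNReal.ofReal (C / 2) * m (Metric.ball x₀ r) <
      minkowskiContent m (Metric.ball x₀ r) := by
    refine lt_of_lt_of_le ?_ h
    refine (ENNReal.mul_lt_mul_iff_left hpos.ne' (hfin r).ne).2 ?_
    exact (ENNReal.ofReal_lt_ofReal_iff hC).2 (by linarith)
  have hev := eventually_lt_of_lt_liminf hlt
  have hmap : Tendsto (fun s : ℝ => s - r) (𝓝[>] r) (𝓝[>] 0) := by
    refine tendsto_nhdsWithin_iff.2 ⟨?_, ?_⟩
    · have : Tendsto (fun s : ℝ => s - r) (𝓝 r) (𝓝 (r - r)) :=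
        Continuous.tendsto (by fun_prop) r
      rw [sub_self] at this
      exact this.mono_left nhdsWithin_le_nhds
    · filter_upwards [self_mem_nhdsWithin] with s hs
      exact sub_pos.2 (mem_Ioi.1 hs)
  -- For `s - r < 2 / C` the exponent `C / 4 * (s - r)` stays below `1 / 2`.
  have hr2 : r < r + 2 / C := by have := div_pos two_pos hC; linarith
  filter_upwards [hmap.eventually hev, Ioo_mem_nhdsGT hr2] with s hs hsr
  have hε : 0 < s - r := sub_pos.2 hsr.1
  have hsub : Metric.thickening (s - r) (Metric.ball x₀ r) ⊆ Metric.ball x₀ s := by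
    refine (Metric.thickening_ball x₀ (s - r) r).trans (Metric.ball_subset_ball (by linarith))
  have h1 : ENNReal.ofReal (C / 2) * m (Metric.ball x₀ r) * ENNReal.ofReal (s - r) ≤
      m (Metric.ball x₀ s) - m (Metric.ball x₀ r) := by
    refine (ENNReal.le_div_iff_mul_le (Or.inl (by simpa using hsr.1))
      (Or.inl ENNReal.ofReal_ne_top)).1 (hs.le.trans ?_)
    gcongr
  have h2 : C / 2 * m.real (Metric.ball x₀ r) * (s - r) ≤
      m.real (Metric.ball x₀ s) - m.real (Metric.ball x₀ r) := by
    have := ENNReal.toReal_mono (ENNReal.sub_ne_top (hfin s).ne) h1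
    rwa [ENNReal.toReal_mul, ENNReal.toReal_mul, ENNReal.toReal_ofReal (by linarith),
      ENNReal.toReal_ofReal hε.le,
      ENNReal.toReal_sub_of_le (measure_mono (Metric.ball_subset_ball hsr.1.le)) (hfin s).ne]
      at this
  have h3 : Real.exp (C / 4 * (s - r)) ≤ 1 + 2 * (C / 4 * (s - r)) := by
    refine Real.exp_le_one_add_two_mul (by positivity) ?_
    have : s - r < 2 / C := by linarith [hsr.2]
    rw [lt_div_iff₀ hC] at this
    linarith
  calc m.real (Metric.ball x₀ r) * Real.exp (C / 4 * (s - r))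
      ≤ m.real (Metric.ball x₀ r) * (1 + 2 * (C / 4 * (s - r))) := by gcongr
    _ ≤ m.real (Metric.ball x₀ s) := by linarith

end OptimalTransport

theorem corollary3p4 {X : Type*} [MetricSpace X] [CompleteSpace X]
    [TopologicalSpace.SeparableSpace X] [NoncompactSpace X]
    [MeasurableSpace X] [BorelSpace X]
    (m : Measure X) [IsLocallyFiniteMeasure m] [m.IsOpenPosMeasure]
    (hCD : OptimalTransport.IsCDZeroInfty m)
    (hent : OptimalTransport.HasVolumeEntropy m 0) :
    ¬ ∃ C : ℝ, 0 < C ∧ ∀ Ω : Set X, MeasurableSet Ω → m Ω < ⊤ →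
      ENNReal.ofReal C * m Ω ≤ OptimalTransport.minkowskiContent m Ω := by
  rintro ⟨C, hC, hiso⟩
  obtain ⟨x₀, hfin, hlim⟩ := hent.exists_measure_ball_lt_top ENNReal.zero_ne_top
  have hpos : ∀ r : ℝ, 0 < r → 0 < m (Metric.ball x₀ r) := fun r hr =>
    Metric.measure_ball_pos m x₀ hr
  have hrpos : ∀ r : ℝ, 0 < r → 0 < m.real (Metric.ball x₀ r) := fun r hr =>
    ENNReal.toReal_pos (hpos r hr).ne' (hfin r).ne
  have hmono : Monotone fun r : ℝ => m.real (Metric.ball x₀ r) := fun r s hrs =>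
    ENNReal.toReal_mono (hfin s).ne (measure_mono (Metric.ball_subset_ball hrs))
  -- The growth starts at radius `1` because `V(0) = 0`.
  have hgrowth : ∀ r : ℝ, 1 ≤ r →
      m.real (Metric.ball x₀ 1) * Real.exp (C / 4 * (r - 1)) ≤ m.real (Metric.ball x₀ r) :=
    fun r hr => hmono.mul_exp_le_of_eventually_right (fun x hx =>
      OptimalTransport.eventually_measureReal_ball_mul_exp_le hfin hC
        (hpos x (by linarith)) (hiso _ measurableSet_ball (hfin x))) hr
  -- Any rate in `(0, C / 4)` would do.
  have hlog : ∀ᶠ r : ℝ in atTop, Real.log (m.real (Metric.ball x₀ r)) / r < C / 8 := by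
    have h0 : ((0 : ℝ≥0∞) : EReal) < ((C / 8 : ℝ) : EReal) := by
      rw [EReal.coe_ennreal_zero]
      exact_mod_cast (by positivity : 0 < C / 8)
    filter_upwards [hlim.eventually_lt_const h0, eventually_gt_atTop 0] with r hr hr0
    rw [ENNReal.log_pos_real (hpos r hr0).ne' (hfin r).ne, ← EReal.coe_div] at hr
    exact_mod_cast hr
  -- The last threshold is where `log V(1) + C / 4 * (r - 1)` overtakes `C / 8 * r`.
  obtain ⟨r, hr, hr1, hr2⟩ := (hlog.and ((eventually_ge_atTop 1).and (eventually_gt_atTop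
    ((C / 4 - Real.log (m.real (Metric.ball x₀ 1))) / (C / 8))))).exists
  have h1 := Real.log_le_log (by have := hrpos 1 one_pos; positivity) (hgrowth r hr1)
  rw [Real.log_mul (hrpos 1 one_pos).ne' (Real.exp_ne_zero _), Real.log_exp] at h1
  rw [div_lt_iff₀ (by linarith)] at hr
  rw [div_lt_iff₀ (by positivity)] at hr2
  linarith
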